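/- **Proposition 4.4.** The statement is a statement of clocked guarded type theory, read in its set-valued denotational semantics. *Setting.* A time object is a finite set $E$ of clocks with a number $\delta(\lambda)\in\mathbb N$ of remaining steps for each $\lambda\in E$; a morphism $(E,\delta)\to(E',\delta')$ is a map $\sigma:E\to E'$ with $\delta'(\sigma(\lambda))\le\delta(\lambda)$ for all $\lambda$. A context $\Gamma$ is a functor from time objects to sets; an hset in context $\Gamma$ is a functor $X$ from the category of elements $(E,\delta,\gamma)$ of $\Gamma$ (with $\gamma\in\Gamma(E,\delta)$) to sets; a clock $\kappa$ in context $\Gamma$ is a natural choice of an element of $E$. The modality $\triangleright^\kappa$ is given by $(\triangleright^\kappa X)(E,\delta,\gamma)=1$ if $\delta(\kappa)=0$, and otherwise $(\triangleright^\kappa X)(E,\delta,\gamma)=X(E,\delta^-,\gamma^-)$, where $\delta^-$ is $\delta$ with $\kappa$ lowered by one and $\gamma^-$ is the restriction of $\gamma$. A monad $T=\langle T,\eta,\mu\rangle$ on hsets is one in the sense internal to type theory: its action on functions is a term $(X\to Y)\to(TX\to TY)$, that is, it acts on maps $P\times X\to Y$ depending on parameters in an arbitrary hset $P$, compatibly with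 substitution for the parameters, and functoriality and naturality of $\eta,\mu$ hold with parameters. A delay algebra is an hset $Y$ with a map $\triangleright^\kappa Y\to Y$. Homomorphisms may likewise depend on parameters. *Statement.* Let $\Gamma$ be a context, $\kappa$ a clock in context $\Gamma$, and $T$ a monad on hsets in context $\Gamma$. 1. For every hset $X$ the guarded recursive type $$(T\oplus D^\kappa)X\;\simeq\;T\bigl(X+\triangleright^\kappa((T\oplus D^\kappa)X)\bigr)$$ exists. 2. Every hset $F$ with an isomorphism $F\cong T(X+\triangleright^\kappa F)$ is the carrier of the free object on $X$ with both a $T$-algebra and a delay algebra structure. Here $F$ has the $T$-algebra structure of the free algebra $T(X+\triangleright^\kappa F)$, and its delay algebra structure $\triangleright^\kappa F\to F$ and the map $u:X\to F$ are the two inclusions into $X+\triangleright^\kappa F$ followed by $\eta$ and the isomorphism. Freeness means: for every hset $Y$ with a $T$-algebra structure and a delay algebra structure, and every $f:X\to Y$ (possibly depending on parameters), there is a unique $\bar f:F\to Y$ that is a homomorphism for both structures and satisfies $\bar f\circ u=f$. 3. The guarded delay monad $D^\kappa$ exists: a monad with $D^\kappa X\simeq X+\triangleright^\kappa(D^\kappa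 X)$ whose unit is the left inclusion and for which the extension $D^\kappa X\to D^\kappa Y$ of any $X\to D^\kappa Y$ is a delay algebra homomorphism. The types $(T\oplus D^\kappa)X$ also carry a monad structure whose unit is the map $u$ of part 2 and for which the extension $(T\oplus D^\kappa)X\to(T\oplus D^\kappa)Y$ of any $X\to(T\oplus D^\kappa)Y$ is a homomorphism for both structures. This monad is the sum of $T$ and $D^\kappa$: algebra structures for $T\oplus D^\kappa$ on an hset $Y$ correspond bijectively to pairs of a $T$-algebra structure and a $D^\kappa$-algebra structure on $Y$, and under this correspondence a map is a homomorphism for $T\oplus D^\kappa$ if and only if it is one for both $T$ and $D^\kappa$. -/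

import Mathlib

/-!
Guarded recursion is interpreted in the usual set-valued denotational semantics of multi-clocked
guarded type theory.  A context `Γ` is a covariant presheaf on the category `TimeObj` of time
objects, an hset in context `Γ` is a covariant presheaf on the category of elements of `Γ`, and a
clock `κ` in context `Γ` is a natural choice of a clock.  A term of type `Y` depending on
`x : X` and on further parameters `p : P` is a morphism `P ⊗ X ⟶ Y`, where `⊗` is the cartesian
product.
-/

open CategoryTheory MonoidalCategory CartesianMonoidalCategory

universe w v

/-- A time object: a finite set of clocks, each with a number of remaining time steps. -/
structure TimeObj where
  /-- the number of clocks -/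
  card : ℕ
  /-- the number of time steps left on each clock -/
  left : Fin card → ℕ

namespace TimeObj

/-- A morphism of time objects is a map of clocks along which the number of remaining steps does
not increase.  It describes passage of time and renaming, identification and creation of clocks. -/
@[ext]
structure Hom (s t : TimeObj) where
  /-- the map on clocks -/
  clk : Fin s.card → Fin t.card
  /-- remaining time does not increase -/
  le : ∀ l, t.left (clk l) ≤ s.left l

instance : Category TimeObj where
  Hom := Hom
  id s := ⟨id, fun _ => le_rfl⟩
  comp f g := ⟨g.clk ∘ f.clk, fun l => (g.le _).trans (f.le l)⟩

/-- The map on clocks of a morphism. -/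
def clkMap {s t : TimeObj} (f : s ⟶ t) : Fin s.card → Fin t.card := Hom.clk f

theorem clkMap_le {s t : TimeObj} (f : s ⟶ t) (l : Fin s.card) :
    t.left (clkMap f l) ≤ s.left l := Hom.le f l

@[simp] theorem clkMap_id (s : TimeObj) : clkMap (𝟙 s) = id := rfl

@[simp] theorem clkMap_comp {s t r : TimeObj} (f : s ⟶ t) (g : t ⟶ r) :
    clkMap (f ≫ g) = clkMap g ∘ clkMap f := rfl

theorem hom_ext {s t : TimeObj} {f g : s ⟶ t} (h : clkMap f = clkMap g) : f = g := Hom.ext h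

/-- The time object after one tick on the clock `l`. -/
def tick (s : TimeObj) (l : Fin s.card) : TimeObj where
  card := s.card
  left := Function.update s.left l (s.left l - 1)

/-- The passage of time from `s` to `s.tick l`. -/
def toTick (s : TimeObj) (l : Fin s.card) : s ⟶ s.tick l :=
  Hom.mk (t := s.tick l) id (fun k => by
    by_cases h : k = l
    · subst h; simp [tick]
    · simp [tick, h])

theorem tickMap_le {s t : TimeObj} (f : s ⟶ t) (l : Fin s.card) (m : Fin t.card)
    (h : clkMap f l = m) (k : Fin s.card) :
    Function.update t.left m (t.left m - 1) (clkMap f k) ≤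
      Function.update s.left l (s.left l - 1) k := by
  have hk := clkMap_le f k
  by_cases h1 : k = l
  · subst h1
    rw [h] at hk ⊢
    simpa using Nat.sub_le_sub_right hk 1
  · rw [Function.update_of_ne h1]
    by_cases h2 : clkMap f k = m
    · rw [h2] at hk ⊢
      rw [Function.update_self]
      omega
    · rwa [Function.update_of_ne h2]

/-- A morphism sending the clock `l` to `m` remains a morphism after a tick on both clocks. -/
def tickMap {s t : TimeObj} (f : s ⟶ t) (l : Fin s.card) (m : Fin t.card)
    (h : clkMap f l = m) : s.tick l ⟶ t.tick m :=
  Hom.mk (s := s.tick l) (t := t.tick m) (clkMap (s := s) (t := t) f) (tickMap_le f l m h)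

end TimeObj

/-- Contexts. -/
abbrev Ctx : Type (w + 1) := TimeObj ⥤ Type w

/-- The category of hsets (families of sets) in context `Γ`. -/
abbrev HSet (Γ : Ctx.{w}) := Γ.Elements ⥤ Type v

/-- A clock in context `Γ`: a map from `Γ` to the presheaf of clocks. -/
structure ClockIn (Γ : Ctx.{w}) where
  /-- the clock at each stage -/
  clk : ∀ {s : TimeObj}, Γ.obj s → Fin s.card
  /-- naturality -/
  nat : ∀ {s t : TimeObj} (f : s ⟶ t) (γ : Γ.obj s), TimeObj.clkMap f (clk γ) = clk (Γ.map f γ)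

namespace ClockIn

variable {Γ : Ctx.{w}} (κ : ClockIn Γ)

/-- The number of time steps left on the clock `κ`. -/
def left (c : Γ.Elements) : ℕ := c.1.left (κ.clk c.2)

theorem clkMap_eq {c d : Γ.Elements} (f : c ⟶ d) :
    TimeObj.clkMap f.1 (κ.clk c.2) = κ.clk d.2 := by
  rw [κ.nat, f.2]

theorem left_le {c d : Γ.Elements} (f : c ⟶ d) : κ.left d ≤ κ.left c := by
  unfold left
  rw [← κ.clkMap_eq f]
  exact TimeObj.clkMap_le f.1 _

/-- The stage after one tick on `κ`. -/
def tickObj (c : Γ.Elements) : Γ.Elements :=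
  ⟨c.1.tick (κ.clk c.2), Γ.map (c.1.toTick (κ.clk c.2)) c.2⟩

/-- The passage of time by one tick on `κ`. -/
def toTick (c : Γ.Elements) : c ⟶ κ.tickObj c := ⟨c.1.toTick (κ.clk c.2), rfl⟩

/-- The action of a tick on `κ` on morphisms of stages. -/
def tickMap {c d : Γ.Elements} (f : c ⟶ d) : κ.tickObj c ⟶ κ.tickObj d :=
  CategoryOfElements.homMk (κ.tickObj c) (κ.tickObj d)
    (TimeObj.tickMap f.1 (κ.clk c.2) (κ.clk d.2) (κ.clkMap_eq f)) (by
      have h : c.1.toTick (κ.clk c.2) ≫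
          TimeObj.tickMap f.1 (κ.clk c.2) (κ.clk d.2) (κ.clkMap_eq f) =
          f.1 ≫ d.1.toTick (κ.clk d.2) := TimeObj.hom_ext (by rfl)
      have h' := congrArg (fun k => Γ.map k c.2) h
      simp only [Functor.map_comp_apply] at h'
      exact h'.trans (congrArg (Γ.map (d.1.toTick (κ.clk d.2))) f.2))

theorem tickMap_id (c : Γ.Elements) : κ.tickMap (𝟙 c) = 𝟙 (κ.tickObj c) :=
  CategoryOfElements.ext _ _ _ (TimeObj.hom_ext (by rfl))

theorem tickMap_comp {c d e : Γ.Elements} (f : c ⟶ d) (g : d ⟶ e) :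
    κ.tickMap (f ≫ g) = κ.tickMap f ≫ κ.tickMap g :=
  CategoryOfElements.ext _ _ _ (TimeObj.hom_ext (by rfl))

theorem toTick_naturality {c d : Γ.Elements} (f : c ⟶ d) :
    f ≫ κ.toTick d = κ.toTick c ≫ κ.tickMap f :=
  CategoryOfElements.ext _ _ _ (TimeObj.hom_ext (by rfl))

/-- The later modality `▷^κ`.  An element of `▷^κ X` at stage `c` is a function that takes a tick
on `κ`, available if some time is left on `κ`, to an element of `X` at the stage after that
tick; so there is exactly one element if no time is left. -/
def later : HSet.{w, v} Γ ⥤ HSet.{w, v} Γ where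
  obj X :=
    { obj := fun c => 0 < κ.left c → X.obj (κ.tickObj c)
      map := fun f => TypeCat.ofHom fun x α => X.map (κ.tickMap f) (x (α.trans_le (κ.left_le f)))
      map_id := fun c => by
        ext x α
        simp [κ.tickMap_id]
      map_comp := fun f g => by
        ext x α
        simp [κ.tickMap_comp] }
  map g :=
    { app := fun c => TypeCat.ofHom fun x α => g.app (κ.tickObj c) (x α)
      naturality := fun c d f => by
        ext x
        exact NatTrans.naturality_apply g (κ.tickMap f) _ }

/-- The action of `▷^κ` on a map that depends on parameters: it sends `p` and `x` to
`λ (α : κ). f p (x [α])`. -/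
def laterCtx {P X Y : HSet.{w, v} Γ} (f : P ⊗ X ⟶ Y) : P ⊗ κ.later.obj X ⟶ κ.later.obj Y where
  app c := TypeCat.ofHom fun z α => f.app (κ.tickObj c) (P.map (κ.toTick c) z.1, z.2 α)
  naturality c d g := by
    ext z
    refine funext fun (α : 0 < κ.left d) => ?_
    have h : P.map (κ.toTick d) (P.map g z.1) = P.map (κ.tickMap g) (P.map (κ.toTick c) z.1) := by
      rw [← Functor.map_comp_apply, ← Functor.map_comp_apply, κ.toTick_naturality]
    have h2 := NatTrans.naturality_apply f (κ.tickMap g)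
      ((P.map (κ.toTick c) z.1, z.2 (α.trans_le (κ.left_le g))) : (P ⊗ X).obj (κ.tickObj c))
    refine Eq.trans ?_ h2
    exact congrArg (fun q => f.app (κ.tickObj d)
      ((q, X.map (κ.tickMap g) (z.2 (α.trans_le (κ.left_le g)))) : (P ⊗ X).obj (κ.tickObj d))) h

end ClockIn

/-- A monad `⟨T, η, μ⟩` on hsets in context `Γ`, in the sense internal to type theory: the action
on functions is itself a term `(X → Y) → (T X → T Y)`, so `T` acts on maps that depend on
parameters `p : P`, and it does so compatibly with substitution for the parameters. -/
structure HMonad (Γ : Ctx.{w}) extends Monad (HSet.{w, v} Γ) where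
  /-- the action on maps with parameters -/
  mapCtx : ∀ {P X Y : HSet.{w, v} Γ}, (P ⊗ X ⟶ Y) → (P ⊗ obj X ⟶ obj Y)
  /-- compatibility with substitution -/
  mapCtx_subst : ∀ {P Q X Y : HSet.{w, v} Γ} (u : Q ⟶ P) (f : P ⊗ X ⟶ Y),
    mapCtx (u ▷ X ≫ f) = u ▷ obj X ≫ mapCtx f
  /-- agreement with `map` on maps that do not depend on the parameters -/
  mapCtx_snd : ∀ {P X Y : HSet.{w, v} Γ} (f : X ⟶ Y),
    mapCtx (snd P X ≫ f) = snd P (obj X) ≫ map f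
  /-- preservation of composition, `T (g ∘ f) = T g ∘ T f` -/
  mapCtx_comp : ∀ {P X Y Z : HSet.{w, v} Γ} (f : P ⊗ X ⟶ Y) (g : P ⊗ Y ⟶ Z),
    mapCtx (lift (fst P X) f ≫ g) = lift (fst P (obj X)) (mapCtx f) ≫ mapCtx g
  /-- naturality of the unit, `T f ∘ η = η ∘ f` -/
  mapCtx_η : ∀ {P X Y : HSet.{w, v} Γ} (f : P ⊗ X ⟶ Y),
    P ◁ η.app X ≫ mapCtx f = f ≫ η.app Y
  /-- naturality of the multiplication, `T f ∘ μ = μ ∘ T (T f)` -/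
  mapCtx_μ : ∀ {P X Y : HSet.{w, v} Γ} (f : P ⊗ X ⟶ Y),
    P ◁ μ.app X ≫ mapCtx f = mapCtx (mapCtx f) ≫ μ.app Y

section Structures

variable {Γ : Ctx.{w}}

/-- The structure of a (monad) algebra for `T` on `Y`. -/
@[ext]
structure AlgOn (T : HMonad.{w, v} Γ) (Y : HSet.{w, v} Γ) where
  /-- the structure map -/
  str : T.obj Y ⟶ Y
  /-- the unit law -/
  unit : T.η.app Y ≫ str = 𝟙 Y
  /-- the associativity law -/
  assoc : T.μ.app Y ≫ str = T.map str ≫ str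

/-- The map `f` with parameters `p : P` is, for all `p`, a homomorphism of `T`-algebras. -/
def IsAlgHom {T : HMonad.{w, v} Γ} {P Y Z : HSet.{w, v} Γ} (A : AlgOn T Y) (B : AlgOn T Z)
    (f : P ⊗ Y ⟶ Z) : Prop :=
  P ◁ A.str ≫ f = T.mapCtx f ≫ B.str

/-- The map `f` with parameters `p : P` is, for all `p`, a homomorphism of delay algebras. -/
def IsDelayHom (κ : ClockIn Γ) {P Y Z : HSet.{w, v} Γ} (ξ : κ.later.obj Y ⟶ Y)
    (ζ : κ.later.obj Z ⟶ Z) (f : P ⊗ Y ⟶ Z) : Prop :=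
  P ◁ ξ ≫ f = κ.laterCtx f ≫ ζ

/-- `F`, with a `T`-algebra structure `A`, a delay algebra structure `ξ` and the map `u`, is the
free object on `X` with both a `T`-algebra and a delay algebra structure: every map `f : X → Y`
to such an object `Y` extends along `u` to a unique homomorphism for both structures.
The parameters `p : P` express that this holds internally, for a variable `f`. -/
def IsFreeOn (κ : ClockIn Γ) (T : HMonad.{w, v} Γ) {X F : HSet.{w, v} Γ} (A : AlgOn T F)
    (ξ : κ.later.obj F ⟶ F) (u : X ⟶ F) : Prop :=
  ∀ (P Y : HSet.{w, v} Γ) (B : AlgOn T Y) (ζ : κ.later.obj Y ⟶ Y) (f : P ⊗ X ⟶ Y),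
    ∃! g : P ⊗ F ⟶ Y, IsAlgHom A B g ∧ IsDelayHom κ ξ ζ g ∧ P ◁ u ≫ g = f

/-- The sum type `X + Y`. -/
abbrev sumType (X Y : HSet.{w, v} Γ) : HSet.{w, v} Γ := FunctorToTypes.coprod X Y

section Canonical

variable (κ : ClockIn Γ) (T : HMonad.{w, v} Γ) {X F : HSet.{w, v} Γ}
  (e : T.obj (sumType X (κ.later.obj F)) ≅ F)

/-- The `T`-algebra structure on a solution `F` of `F ≃ T (X + ▷^κ F)`: the free `T`-algebra
structure transported along the equivalence. -/
def recAlg : AlgOn T F where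
  str := T.map e.inv ≫ T.μ.app _ ≫ e.hom
  unit := by
    have h := T.toMonad.unit_naturality _ e.inv
    rw [← Category.assoc, ← h, Category.assoc, T.toMonad.left_unit_assoc, e.inv_hom_id]
  assoc := by
    have h := T.toMonad.mu_naturality _ e.inv
    have h2 := T.toMonad.assoc (sumType X (κ.later.obj F))
    have h3 : T.map e.hom ≫ T.map e.inv = 𝟙 _ := by
      rw [← Functor.map_comp, e.hom_inv_id, CategoryTheory.Functor.map_id]
    rw [Functor.map_comp, Functor.map_comp]
    simp only [Category.assoc]
    rw [reassoc_of% h3, reassoc_of% h2, reassoc_of% h]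

/-- The delay algebra structure on a solution `F` of `F ≃ T (X + ▷^κ F)`. -/
def recStep : κ.later.obj F ⟶ F := FunctorToTypes.coprod.inr ≫ T.η.app _ ≫ e.hom

/-- The inclusion of `X` in a solution `F` of `F ≃ T (X + ▷^κ F)`. -/
def recUnit : X ⟶ F := FunctorToTypes.coprod.inl ≫ T.η.app _ ≫ e.hom

end Canonical

/-- `D` is the guarded delay monad: `D X` is the guarded recursive type `D X ≃ X + ▷^κ (D X)` with
inclusions `now` and `step`, the unit is `now`, and the extension `D X → D Y` of a map
`f : X → D Y` given by the monad structure is a homomorphism of delay algebras. -/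
structure IsDelayMonad (κ : ClockIn Γ) (D : HMonad.{w, v} Γ)
    (e : ∀ X : HSet.{w, v} Γ, sumType X (κ.later.obj (D.obj X)) ≅ D.obj X) : Prop where
  unit : ∀ X, D.η.app X = FunctorToTypes.coprod.inl ≫ (e X).hom
  bind_step : ∀ {P X Y : HSet.{w, v} Γ} (f : P ⊗ X ⟶ D.obj Y),
    IsDelayHom κ (FunctorToTypes.coprod.inr ≫ (e X).hom) (FunctorToTypes.coprod.inr ≫ (e Y).hom)
      (D.mapCtx f ≫ D.μ.app Y)

/-- `R` is the monad `T ⊕ D^κ`: `R X` is the guarded recursive type `R X ≃ T (X + ▷^κ (R X))`,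
the unit is the inclusion of `X`, and the extension `R X → R Y` of a map `f : X → R Y` given by the
monad structure is a homomorphism for the `T`-algebra and delay algebra structures. -/
structure IsFreeComb (κ : ClockIn Γ) (T R : HMonad.{w, v} Γ)
    (e : ∀ X : HSet.{w, v} Γ, T.obj (sumType X (κ.later.obj (R.obj X))) ≅ R.obj X) : Prop where
  unit : ∀ X, R.η.app X = recUnit κ T (e X)
  bind_alg : ∀ {P X Y : HSet.{w, v} Γ} (f : P ⊗ X ⟶ R.obj Y),
    IsAlgHom (recAlg κ T (e X)) (recAlg κ T (e Y)) (R.mapCtx f ≫ R.μ.app Y)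
  bind_step : ∀ {P X Y : HSet.{w, v} Γ} (f : P ⊗ X ⟶ R.obj Y),
    IsDelayHom κ (recStep κ T (e X)) (recStep κ T (e Y)) (R.mapCtx f ≫ R.μ.app Y)

/-- `R` is the sum of the monads `T` and `S`: an `R`-algebra structure on an hset is the same as a
pair of a `T`-algebra structure and an `S`-algebra structure, with the same homomorphisms. -/
def IsMonadSum (R T S : HMonad.{w, v} Γ) : Prop :=
  ∃ Φ : ∀ Y : HSet.{w, v} Γ, AlgOn R Y ≃ AlgOn T Y × AlgOn S Y,
    ∀ {P Y Z : HSet.{w, v} Γ} (A : AlgOn R Y) (B : AlgOn R Z) (f : P ⊗ Y ⟶ Z),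
      IsAlgHom A B f ↔ IsAlgHom (Φ Y A).1 (Φ Z B).1 f ∧ IsAlgHom (Φ Y A).2 (Φ Z B).2 f

end Structures

/-! A guarded equation is solved by induction on the number of steps left on `κ`: an element of `▷^κ
X` with less than `n + 1` steps left only involves `X` with less than `n` steps left. This is used
once for types and once for maps. For types, a functor that turns bijectivity below `n` into
bijectivity below `n + 1` has a fixed point, the limit of its iterates on the terminal object
(`exists_fixed_of_contractive`). The functor `F ↦ T (X + ▷^κ F)` qualifies because `▷^κ` gains one
step and `T`, acting on maps with parameters, loses none (`BijBelow.map`). For maps, across `F ≅ T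
(X + ▷^κ F)` a `T`-homomorphism out of `F` is determined on the generators `X + ▷^κ F`. Extending
`f` to a homomorphism for both structures therefore means solving a fixed point equation for `g`
(`hom_iff_fixed`) in which `g` occurs only under `▷^κ`. Such an equation has a unique solution
(`existsUnique_fixed`), which is freeness. Everything else follows from freeness with parameters.
The monad laws, the correspondence of algebras and the comparison of homomorphisms all reduce to
equalities between homomorphisms that agree on generators. The delay monad is the case where `T` is
the identity. -/

namespace HSet

/-! ### Maps with parameters out of products and sums. -/

variable {Γ : Ctx.{w}}

theorem tensor_ext {P X Y : HSet.{w, v} Γ} {f g : P ⊗ X ⟶ Y}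
    (h : ∀ c (p : P.obj c) (x : X.obj c),
      f.app c ((p, x) : (P ⊗ X).obj c) = g.app c ((p, x) : (P ⊗ X).obj c)) : f = g := by
  ext c z
  exact h c z.1 z.2

theorem hom_ext_iff {X Y : HSet.{w, v} Γ} {f g : X ⟶ Y} :
    f = g ↔ ∀ c (x : X.obj c), f.app c x = g.app c x :=
  ⟨fun h _ _ => by rw [h], fun h => by ext c x; exact h c x⟩

/-- Two maps with parameters out of a sum agree if they agree on both summands. -/
theorem sum_hom_ext {P X Y Z : HSet.{w, v} Γ} {f g : P ⊗ sumType X Y ⟶ Z}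
    (hl : P ◁ FunctorToTypes.coprod.inl ≫ f = P ◁ FunctorToTypes.coprod.inl ≫ g)
    (hr : P ◁ FunctorToTypes.coprod.inr ≫ f = P ◁ FunctorToTypes.coprod.inr ≫ g) : f = g := by
  refine tensor_ext fun c p x => ?_
  rcases x with x | y
  · exact hom_ext_iff.1 hl c ((p, x) : (P ⊗ X).obj c)
  · exact hom_ext_iff.1 hr c ((p, y) : (P ⊗ Y).obj c)

/-- Case distinction for maps with parameters. -/
def sumDesc {P X Y Z : HSet.{w, v} Γ} (f : P ⊗ X ⟶ Z) (g : P ⊗ Y ⟶ Z) :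
    P ⊗ sumType X Y ⟶ Z where
  app c := TypeCat.ofHom fun z => Sum.elim (fun x => f.app c ((z.1, x) : (P ⊗ X).obj c))
    (fun y => g.app c ((z.1, y) : (P ⊗ Y).obj c)) z.2
  naturality c d h := by
    ext ⟨p, x | y⟩
    · exact NatTrans.naturality_apply f h ((p, x) : (P ⊗ X).obj c)
    · exact NatTrans.naturality_apply g h ((p, y) : (P ⊗ Y).obj c)

@[simp]
theorem inl_sumDesc {P X Y Z : HSet.{w, v} Γ} (f : P ⊗ X ⟶ Z) (g : P ⊗ Y ⟶ Z) :
    P ◁ FunctorToTypes.coprod.inl ≫ sumDesc f g = f := rfl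

@[simp]
theorem inr_sumDesc {P X Y Z : HSet.{w, v} Γ} (f : P ⊗ X ⟶ Z) (g : P ⊗ Y ⟶ Z) :
    P ◁ FunctorToTypes.coprod.inr ≫ sumDesc f g = g := rfl

theorem sumDesc_subst {P Q X Y Z : HSet.{w, v} Γ} (u : Q ⟶ P) (f : P ⊗ X ⟶ Z) (g : P ⊗ Y ⟶ Z) :
    sumDesc (u ▷ X ≫ f) (u ▷ Y ≫ g) = u ▷ sumType X Y ≫ sumDesc f g :=
  sum_hom_ext rfl rfl

end HSet

/-! ### Functors acting on maps with parameters, and homomorphisms of their algebras. -/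

/-- A functor on hsets in the sense internal to type theory. -/
structure CtxFunctor (Γ : Ctx.{w}) extends HSet.{w, v} Γ ⥤ HSet.{w, v} Γ where
  /-- the action on maps with parameters -/
  mapCtx : ∀ {P X Y : HSet.{w, v} Γ}, (P ⊗ X ⟶ Y) → (P ⊗ obj X ⟶ obj Y)
  mapCtx_subst : ∀ {P Q X Y : HSet.{w, v} Γ} (u : Q ⟶ P) (f : P ⊗ X ⟶ Y),
    mapCtx (u ▷ X ≫ f) = u ▷ obj X ≫ mapCtx f
  mapCtx_snd : ∀ {P X Y : HSet.{w, v} Γ} (f : X ⟶ Y),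
    mapCtx (snd P X ≫ f) = snd P (obj X) ≫ map f
  mapCtx_comp : ∀ {P X Y Z : HSet.{w, v} Γ} (f : P ⊗ X ⟶ Y) (g : P ⊗ Y ⟶ Z),
    mapCtx (lift (fst P X) f ≫ g) = lift (fst P (obj X)) (mapCtx f) ≫ mapCtx g

namespace CtxFunctor

variable {Γ : Ctx.{w}} (M : CtxFunctor.{w, v} Γ) {P Q X Y Z : HSet.{w, v} Γ}

theorem mapCtx_comp_map (f : P ⊗ X ⟶ Y) (h : Y ⟶ Z) :
    M.mapCtx (f ≫ h) = M.mapCtx f ≫ M.map h := by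
  have := M.mapCtx_comp f (snd P Y ≫ h)
  rwa [M.mapCtx_snd, lift_snd_assoc, lift_snd_assoc] at this

theorem mapCtx_whiskerLeft (h : X ⟶ Y) (f : P ⊗ Y ⟶ Z) :
    M.mapCtx (P ◁ h ≫ f) = P ◁ M.map h ≫ M.mapCtx f := by
  have := M.mapCtx_comp (snd P X ≫ h) f
  rw [M.mapCtx_snd] at this
  have e : ∀ {A B : HSet.{w, v} Γ} (k : A ⟶ B), lift (fst P A) (snd P A ≫ k) = P ◁ k := by
    intro A B k; ext1 <;> simp
  rwa [e, e] at this

/-- `f` is, for all parameters, a homomorphism from the `M`-algebra `a` to `b`. -/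
def IsHom {P Y Z : HSet.{w, v} Γ} (a : M.obj Y ⟶ Y) (b : M.obj Z ⟶ Z) (f : P ⊗ Y ⟶ Z) : Prop :=
  P ◁ a ≫ f = M.mapCtx f ≫ b

variable {M} {a : M.obj X ⟶ X} {b : M.obj Y ⟶ Y} {c : M.obj Z ⟶ Z}

theorem isHom_snd_comp {f : X ⟶ Y} (h : a ≫ f = M.map f ≫ b) : M.IsHom a b (snd P X ≫ f) := by
  rw [IsHom, M.mapCtx_snd, whiskerLeft_snd_assoc, h, Category.assoc]

theorem isHom_snd : M.IsHom a a (snd P X) := by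
  have : M.IsHom a a (snd P X ≫ 𝟙 X) := isHom_snd_comp (by simp)
  rwa [Category.comp_id] at this

/-- This closure property, with those under composition below, supplies the homomorphisms to which
uniqueness of extensions is applied. Stating them for a general `M` covers `T` and `▷^κ` at once. -/
theorem IsHom.subst {f : P ⊗ X ⟶ Y} (h : M.IsHom a b f) (u : Q ⟶ P) :
    M.IsHom a b (u ▷ X ≫ f) := by
  rw [IsHom] at h ⊢
  rw [M.mapCtx_subst, Category.assoc, ← h, whisker_exchange_assoc]

theorem IsHom.comp {f : P ⊗ X ⟶ Y} {g : P ⊗ Y ⟶ Z} (hf : M.IsHom a b f) (hg : M.IsHom b c g) :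
    M.IsHom a c (lift (fst P X) f ≫ g) := by
  rw [IsHom] at hf hg ⊢
  have e : P ◁ a ≫ lift (fst P X) f = lift (fst P _) (M.mapCtx f) ≫ P ◁ b := by
    ext1
    · simp
    · simpa using hf
  rw [M.mapCtx_comp, Category.assoc, ← hg, reassoc_of% e]

theorem IsHom.comp_right {f : P ⊗ X ⟶ Y} (hf : M.IsHom a b f) {g : Y ⟶ Z}
    (hg : b ≫ g = M.map g ≫ c) : M.IsHom a c (f ≫ g) := by
  rw [IsHom] at hf ⊢
  rw [M.mapCtx_comp_map, reassoc_of% hf, hg, Category.assoc]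

theorem IsHom.comp_left {f : X ⟶ Y} (hf : a ≫ f = M.map f ≫ b) {g : P ⊗ Y ⟶ Z}
    (hg : M.IsHom b c g) : M.IsHom a c (P ◁ f ≫ g) := by
  rw [IsHom] at hg ⊢
  rw [M.mapCtx_whiskerLeft, Category.assoc, ← hg, ← whiskerLeft_comp_assoc,
    ← whiskerLeft_comp_assoc, hf]

/-- A homomorphism with parameters that does not depend on them is a homomorphism. -/
theorem IsHom.of_snd {f : X ⟶ Y} (h : M.IsHom a b (snd (𝟙_ (HSet.{w, v} Γ)) X ≫ f)) :
    a ≫ f = M.map f ≫ b := by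
  rw [IsHom, M.mapCtx_snd, whiskerLeft_snd_assoc, Category.assoc] at h
  -- Precomposing with the section `x ↦ (*, x)` of the projection removes the trivial parameter.
  have := congrArg (fun k => lift (toUnit _) (𝟙 _) ≫ k) h
  simpa using this

end CtxFunctor

/-- The functor underlying a monad. -/
abbrev HMonad.ctxFunctor {Γ : Ctx.{w}} (T : HMonad.{w, v} Γ) : CtxFunctor.{w, v} Γ :=
  { T with }

namespace ClockIn

variable {Γ : Ctx.{w}} (κ : ClockIn Γ)

/-- The later modality as a functor in the internal sense. -/
abbrev laterFunctor : CtxFunctor.{w, v} Γ where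
  toFunctor := κ.later
  mapCtx f := κ.laterCtx f
  mapCtx_subst u f := by
    refine HSet.tensor_ext fun c q x => funext fun α => ?_
    exact congrArg (fun p => f.app (κ.tickObj c) (p, x α))
      (NatTrans.naturality_apply u (κ.toTick c) q)
  mapCtx_snd f := rfl
  mapCtx_comp f g := rfl

end ClockIn

/-! ### Stages with bounded time left, and guarded fixed points of maps. -/

namespace ClockIn

variable {Γ : Ctx.{w}} (κ : ClockIn Γ)

theorem left_tickObj (c : Γ.Elements) : κ.left (κ.tickObj c) = κ.left c - 1 := by
  -- Naturality of `κ` ensures that the clock selected after the tick is the one that was ticked.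
  have h := κ.clkMap_eq (κ.toTick c)
  unfold left
  rw [← h]
  exact Function.update_self ..

/-- The part of `P` where less than `n` steps are left on `κ`. -/
def below (n : ℕ) (P : HSet.{w, v} Γ) : HSet.{w, v} Γ where
  obj c := { _p : P.obj c // κ.left c < n }
  map f := TypeCat.ofHom fun p => ⟨P.map f p.1, (κ.left_le f).trans_lt p.2⟩
  map_id c := by ext p; exact Functor.map_id_apply P c p.1
  map_comp f g := by ext p; exact Functor.map_comp_apply P f g p.1

/-- The inclusion of the part where less than `n` steps are left. -/
def belowIncl (n : ℕ) (P : HSet.{w, v} Γ) : κ.below n P ⟶ P where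
  app c := TypeCat.ofHom fun p => p.1

/-- The inclusion of the part where less than `n` steps are left in the next one. -/
def belowStep (n : ℕ) (P : HSet.{w, v} Γ) : κ.below n P ⟶ κ.below (n + 1) P where
  app c := TypeCat.ofHom fun p => ⟨p.1, p.2.trans n.lt_succ_self⟩

/-- The map `p ↦ λ (α : κ). p [α]`. -/
def next (P : HSet.{w, v} Γ) : P ⟶ κ.later.obj P where
  app c := TypeCat.ofHom fun p _ => P.map (κ.toTick c) p
  naturality c d f := by
    ext p
    refine funext fun α => ?_
    change P.map (κ.toTick d) (P.map f p) = P.map (κ.tickMap f) (P.map (κ.toTick c) p)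
    rw [← Functor.map_comp_apply, ← Functor.map_comp_apply, κ.toTick_naturality]

/-- After a tick, one step less is left. -/
def belowNext (n : ℕ) (P : HSet.{w, v} Γ) : κ.below (n + 1) P ⟶ κ.later.obj (κ.below n P) where
  app c := TypeCat.ofHom fun p α => ⟨P.map (κ.toTick c) p.1, by
    -- The tick `α` says that time is left, so the truncated subtraction really decreases; this
    -- matters when `n = 0`.
    have h := p.2
    rw [κ.left_tickObj]
    omega⟩
  naturality c d f := by
    ext p
    refine funext fun α => Subtype.ext ?_
    exact congrFun (NatTrans.naturality_apply (κ.next P) f p.1) α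

/-- The action of `▷^κ` on a map with delayed parameters. -/
def laterAlong {P Q X Y : HSet.{w, v} Γ} (δ : Q ⟶ κ.later.obj P) (f : P ⊗ X ⟶ Y) :
    Q ⊗ κ.later.obj X ⟶ κ.later.obj Y where
  app c := TypeCat.ofHom fun z α => f.app (κ.tickObj c) ((δ.app c z.1 : _) α, z.2 α)
  naturality c d g := by
    ext z
    refine funext fun (α : 0 < κ.left d) => ?_
    have h := congrFun (NatTrans.naturality_apply δ g z.1) α
    have h2 := NatTrans.naturality_apply f (κ.tickMap g)
      (((δ.app c z.1 : _) (α.trans_le (κ.left_le g)), z.2 (α.trans_le (κ.left_le g))) :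
        (P ⊗ X).obj (κ.tickObj c))
    refine Eq.trans ?_ h2
    exact congrArg (fun q => f.app (κ.tickObj d)
      ((q, X.map (κ.tickMap g) (z.2 (α.trans_le (κ.left_le g)))) : (P ⊗ X).obj (κ.tickObj d))) h

variable {P F Y : HSet.{w, v} Γ}

/-- Each stage `c` lies in some bounded part, the least bound being `κ.left c + 1`. -/
theorem hom_ext_below {g g' : P ⊗ F ⟶ Y}
    (h : ∀ n, κ.belowIncl n P ▷ F ≫ g = κ.belowIncl n P ▷ F ≫ g') : g = g' :=
  HSet.tensor_ext fun c p x => HSet.hom_ext_iff.1 (h (κ.left c + 1)) c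
    (((⟨p, Nat.lt_succ_self _⟩ : { _p : P.obj c // κ.left c < κ.left c + 1 }), x) :
      (κ.below (κ.left c + 1) P ⊗ F).obj c)

theorem hom_ext_below_zero (g g' : κ.below 0 P ⊗ F ⟶ Y) : g = g' :=
  HSet.tensor_ext fun _ p _ => absurd p.2 (Nat.not_lt_zero _)

/-- The only map defined where less than zero steps are left. -/
def belowZeroDesc : κ.below 0 P ⊗ F ⟶ Y where
  app _ := TypeCat.ofHom fun z => absurd z.1.2 (Nat.not_lt_zero _)
  naturality _ _ _ := by
    ext z
    exact absurd z.1.2 (Nat.not_lt_zero _)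

/-- Compatible partial maps, defined where a bounded number of steps is left, can be glued. -/
theorem exists_glue (s : ∀ n, κ.below n P ⊗ F ⟶ Y)
    (hs : ∀ n, κ.belowStep n P ▷ F ≫ s (n + 1) = s n) :
    ∃ g : P ⊗ F ⟶ Y, ∀ n, κ.belowIncl n P ▷ F ≫ g = s n := by
  let val (n : ℕ) (c : Γ.Elements) (p : P.obj c) (x : F.obj c) (h : κ.left c < n) : Y.obj c :=
    (s n).app c (((⟨p, h⟩ : { _p : P.obj c // κ.left c < n }), x) : (κ.below n P ⊗ F).obj c)
  -- The value does not depend on the bound used to compute it, by induction on the difference of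
  -- two bounds.
  have key : ∀ n k c p x h h', val (n + k) c p x h' = val n c p x h := by
    intro n k c p x h
    induction k with
    | zero => intro _; rfl
    | succ k ih =>
      intro h'
      rw [← ih (h.trans_le (Nat.le_add_right n k))]
      exact HSet.hom_ext_iff.1 (hs (n + k)) c
        (((⟨p, h.trans_le (Nat.le_add_right n k)⟩ : { _p : P.obj c // κ.left c < n + k }), x) :
          (κ.below (n + k) P ⊗ F).obj c)
  have key' : ∀ n m c p x h h', val n c p x h = val m c p x h' := by
    intro n m c p x h h'
    rcases Nat.le_total n m with hnm | hnm
    · obtain ⟨k, rfl⟩ := Nat.exists_eq_add_of_le hnm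
      exact (key n k c p x h h').symm
    · obtain ⟨k, rfl⟩ := Nat.exists_eq_add_of_le hnm
      exact key m k c p x h' h
  refine ⟨{ app := fun c => TypeCat.ofHom fun z => val (κ.left c + 1) c z.1 z.2 (Nat.lt_succ_self _)
            naturality := fun c d f => ?_ }, fun n => ?_⟩
  · ext z
    -- The bound belonging to `c` also works at `d`, since time does not increase along `f`;
    -- naturality of that single partial map suffices.
    refine Eq.trans ?_ (NatTrans.naturality_apply (s (κ.left c + 1)) f
      (((⟨z.1, Nat.lt_succ_self _⟩ : { _p : P.obj c // κ.left c < κ.left c + 1 }), z.2) :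
        (κ.below (κ.left c + 1) P ⊗ F).obj c))
    exact key' _ _ _ _ _ _ ((κ.left_le f).trans_lt (Nat.lt_succ_self _))
  · exact HSet.tensor_ext fun c p x => key' _ _ _ _ _ _ p.2

/-- A contractive operator on maps with parameters has a unique fixed point. -/
theorem existsUnique_fixed (Ψ : (P ⊗ F ⟶ Y) → (P ⊗ F ⟶ Y))
    (Ψ' : ∀ n, (κ.below n P ⊗ F ⟶ Y) → (κ.below (n + 1) P ⊗ F ⟶ Y))
    (h : ∀ n g, κ.belowIncl (n + 1) P ▷ F ≫ Ψ g = Ψ' n (κ.belowIncl n P ▷ F ≫ g))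
    (h' : ∀ n g, κ.belowStep (n + 1) P ▷ F ≫ Ψ' (n + 1) g = Ψ' n (κ.belowStep n P ▷ F ≫ g)) :
    ∃! g, Ψ g = g := by
  -- `Ψ' n` computes `Ψ g` below `n + 1` from `g` below `n`. Iterating it from the empty part gives
  -- the only possible restrictions of a fixed point, and `h'` makes them compatible.
  let s : ∀ n, κ.below n P ⊗ F ⟶ Y := fun n => n.rec κ.belowZeroDesc fun n g => Ψ' n g
  have hs : ∀ n, κ.belowStep n P ▷ F ≫ s (n + 1) = s n := by
    intro n
    induction n with
    | zero => exact κ.hom_ext_below_zero _ _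
    | succ n ih => exact (h' n (s (n + 1))).trans (congrArg (Ψ' n) ih)
  obtain ⟨g, hg⟩ := κ.exists_glue s hs
  refine ⟨g, κ.hom_ext_below fun n => ?_, fun g' hg' => κ.hom_ext_below fun n => ?_⟩
  · cases n with
    | zero => exact κ.hom_ext_below_zero _ _
    | succ n => rw [h, hg, hg]
  · rw [hg]
    induction n with
    | zero => exact κ.hom_ext_below_zero _ _
    | succ n ih => rw [← hg', h, ih]

end ClockIn

/-! ### Every solution of the recursive equation is free. -/

section Free

variable {Γ : Ctx.{w}} {T : HMonad.{w, v} Γ} {P X Y Z F : HSet.{w, v} Γ}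

theorem whiskerLeft_comp₃ {A B C D : HSet.{w, v} Γ} (a : A ⟶ B) (b : B ⟶ C) (c : C ⟶ D)
    (g : P ⊗ D ⟶ Y) : P ◁ (a ≫ b ≫ c) ≫ g = P ◁ a ≫ P ◁ b ≫ P ◁ c ≫ g := by
  simp only [whiskerLeft_comp, Category.assoc]

/-- Naturality of `μ` and associativity of `B` give this. With the next two lemmas it is the
universal property, with parameters, of the free `T`-algebra on `Z`. -/
theorem AlgOn.isHom_extend (B : AlgOn T Y) (h : P ⊗ Z ⟶ Y) :
    T.ctxFunctor.IsHom (T.μ.app Z) B.str (T.mapCtx h ≫ B.str) := by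
  rw [CtxFunctor.IsHom]
  have h1 := T.mapCtx_μ h
  have h2 := T.ctxFunctor.mapCtx_comp_map (T.mapCtx h) B.str
  dsimp only at h2 ⊢
  rw [h2, reassoc_of% h1, Category.assoc, B.assoc]

theorem AlgOn.η_extend (B : AlgOn T Y) (h : P ⊗ Z ⟶ Y) :
    P ◁ T.η.app Z ≫ T.mapCtx h ≫ B.str = h := by
  have h1 := T.mapCtx_η h
  rw [reassoc_of% h1, B.unit]
  exact Category.comp_id h

theorem AlgOn.eq_extend (B : AlgOn T Y) {g : P ⊗ T.obj Z ⟶ Y}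
    (hg : T.ctxFunctor.IsHom (T.μ.app Z) B.str g) :
    g = T.mapCtx (P ◁ T.η.app Z ≫ g) ≫ B.str := by
  have h1 := T.ctxFunctor.mapCtx_whiskerLeft (T.η.app Z) g
  have h2 := T.right_unit Z
  rw [CtxFunctor.IsHom] at hg
  dsimp only at h1 h2 hg
  erw [h1]
  rw [Category.assoc, ← hg, ← whiskerLeft_comp_assoc]
  erw [h2]
  simp

variable (κ : ClockIn Γ) (e : T.obj (sumType X (κ.later.obj F)) ≅ F)

theorem recAlg_iso_hom :
    T.μ.app _ ≫ e.hom = T.map e.hom ≫ (recAlg κ T e).str := by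
  have h3 : T.map e.hom ≫ T.map e.inv = 𝟙 _ := by
    rw [← Functor.map_comp, e.hom_inv_id, CategoryTheory.Functor.map_id]
  rw [recAlg, reassoc_of% h3]

theorem recAlg_iso_inv :
    (recAlg κ T e).str ≫ e.inv = T.map e.inv ≫ T.μ.app _ := by
  simp [recAlg]

/-- Across `e`, `F` is the free `T`-algebra on `X + ▷^κ F`, so a `T`-homomorphism `g` is the
extension of its restriction to generators. The other two conditions prescribe that restriction: `f`
on `X`, and `ζ` after the delayed `g` on `▷^κ F`. -/
theorem hom_iff_fixed (B : AlgOn T Y) (ζ : κ.later.obj Y ⟶ Y) (f : P ⊗ X ⟶ Y) (g : P ⊗ F ⟶ Y) :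
    (IsAlgHom (recAlg κ T e) B g ∧ IsDelayHom κ (recStep κ T e) ζ g ∧
      P ◁ recUnit κ T e ≫ g = f) ↔
    P ◁ e.inv ≫ T.mapCtx (HSet.sumDesc f (κ.laterCtx g ≫ ζ)) ≫ B.str = g := by
  have e1 : ∀ k : P ⊗ F ⟶ Y, P ◁ e.inv ≫ P ◁ e.hom ≫ k = k := fun k => by
    rw [← whiskerLeft_comp_assoc, e.inv_hom_id]; simp
  have e2 : ∀ k : P ⊗ _ ⟶ Y, P ◁ e.hom ≫ P ◁ e.inv ≫ k = k := fun k => by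
    rw [← whiskerLeft_comp_assoc, e.hom_inv_id]; simp
  constructor
  · rintro ⟨h1, h2, h3⟩
    have h4 : T.ctxFunctor.IsHom (T.μ.app _) B.str (P ◁ e.hom ≫ g) :=
      CtxFunctor.IsHom.comp_left (M := T.ctxFunctor) (recAlg_iso_hom κ e) h1
    have h5 := B.eq_extend h4
    have h6 : P ◁ T.η.app _ ≫ P ◁ e.hom ≫ g = HSet.sumDesc f (κ.laterCtx g ≫ ζ) := by
      refine HSet.sum_hom_ext ?_ ?_
      · rw [HSet.inl_sumDesc, ← h3, recUnit]
        exact (whiskerLeft_comp₃ ..).symm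
      · rw [HSet.inr_sumDesc, ← h2, recStep]
        exact (whiskerLeft_comp₃ ..).symm
    rw [← h6, ← h5, e1]
  · intro h
    have h4 : T.ctxFunctor.IsHom (recAlg κ T e).str B.str g := by
      rw [← h]
      exact CtxFunctor.IsHom.comp_left (M := T.ctxFunctor) (recAlg_iso_inv κ e)
        (B.isHom_extend _)
    have h6 : P ◁ T.η.app _ ≫ P ◁ e.hom ≫ g = HSet.sumDesc f (κ.laterCtx g ≫ ζ) := by
      conv_lhs => rw [← h]
      rw [e2]
      exact B.η_extend _
    refine ⟨h4, ?_, ?_⟩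
    · rw [IsDelayHom, recStep, ← HSet.inr_sumDesc f (κ.laterCtx g ≫ ζ), ← h6]
      exact whiskerLeft_comp₃ ..
    · rw [recUnit, ← HSet.inl_sumDesc f (κ.laterCtx g ≫ ζ), ← h6]
      exact whiskerLeft_comp₃ ..

theorem isFreeOn_rec : IsFreeOn κ T (recAlg κ T e) (recStep κ T e) (recUnit κ T e) := by
  intro P Y B ζ f
  simp only [hom_iff_fixed]
  have subst : ∀ {Q Q' : HSet.{w, v} Γ} (u : Q' ⟶ Q) (k : Q ⊗ _ ⟶ Y),
      u ▷ F ≫ Q ◁ e.inv ≫ T.mapCtx k ≫ B.str = Q' ◁ e.inv ≫ T.mapCtx (u ▷ _ ≫ k) ≫ B.str := by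
    intro Q Q' u k
    rw [T.mapCtx_subst, Category.assoc, whisker_exchange_assoc]
  -- The operator uses `g` only under `▷^κ`, where the parameters have undergone a tick; by
  -- `belowNext` it is enough to know `g` below `n`. Both compatibilities then come from
  -- substitution in the parameters.
  refine κ.existsUnique_fixed _ (fun n g => κ.below (n + 1) P ◁ e.inv ≫ T.mapCtx
    (HSet.sumDesc (κ.belowIncl (n + 1) P ▷ X ≫ f) (κ.laterAlong (κ.belowNext n P) g ≫ ζ)) ≫ B.str)
    (fun n g => ?_) (fun n g => ?_)
  · rw [subst, ← HSet.sumDesc_subst]; rfl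
  · rw [subst, ← HSet.sumDesc_subst]; rfl

end Free

/-! ### Existence of guarded recursive types. -/

namespace ClockIn

variable {Γ : Ctx.{w}} (κ : ClockIn Γ) {A B X : HSet.{w, v} Γ}

/-- The map `f` is bijective at all stages with less than `n` steps left on `κ`. -/
def BijBelow (n : ℕ) (f : A ⟶ B) : Prop :=
  ∀ c, κ.left c < n → Function.Bijective (f.app c)

variable {κ}

theorem BijBelow.mono {n m : ℕ} {f : A ⟶ B} (h : κ.BijBelow n f) (hm : m ≤ n) :
    κ.BijBelow m f := fun c hc => h c (hc.trans_le hm)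

/-- If time is left, the components are those of `f` one tick later, with one step less; if none is
left, both sides are singletons. -/
theorem BijBelow.later {n : ℕ} {f : A ⟶ B} (h : κ.BijBelow n f) :
    κ.BijBelow (n + 1) (κ.later.map f) := by
  intro c hc
  have hb : 0 < κ.left c → Function.Bijective (f.app (κ.tickObj c)) := fun α =>
    h _ (by rw [κ.left_tickObj]; omega)
  refine ⟨fun x y hxy => funext fun α => (hb α).1 (congrFun hxy α), fun y => ?_⟩
  exact ⟨fun α => ((hb α).2 (y α)).choose, funext fun α => ((hb α).2 (y α)).choose_spec⟩

/-- The action on maps of the sum with `X`. -/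
def sumMapRight (X : HSet.{w, v} Γ) (f : A ⟶ B) : sumType X A ⟶ sumType X B :=
  FunctorToTypes.coprod.desc FunctorToTypes.coprod.inl (f ≫ FunctorToTypes.coprod.inr)

theorem BijBelow.sumMapRight {n : ℕ} {f : A ⟶ B} (h : κ.BijBelow n f) :
    κ.BijBelow n (sumMapRight X f) := by
  intro c hc
  have : ((ClockIn.sumMapRight X f).app c : X.obj c ⊕ A.obj c → X.obj c ⊕ B.obj c) =
      Sum.map id (f.app c) := by
    ext (x | a) <;> rfl
  change Function.Bijective
    ((ClockIn.sumMapRight X f).app c : X.obj c ⊕ A.obj c → X.obj c ⊕ B.obj c)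
  rw [this]
  exact ⟨Function.injective_id.sumMap (h c hc).1, Function.surjective_id.sumMap (h c hc).2⟩

/-- A functor in the internal sense acts locally. -/
theorem BijBelow.map (M : CtxFunctor.{w, v} Γ) {n : ℕ} {f : A ⟶ B} (h : κ.BijBelow n f) :
    κ.BijBelow n (M.map f) := by
  -- The proposition "less than `n` steps are left" serves as parameter. Over it `f` has an inverse
  -- `s`, and `M.mapCtx s` inverts `M.map f` wherever `V` is inhabited.
  let V : HSet.{w, v} Γ := κ.below n (𝟙_ _)
  let s : V ⊗ B ⟶ A :=
    { app := fun c => TypeCat.ofHom fun z => (Equiv.ofBijective _ (h c z.1.2)).symm z.2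
      naturality := fun c d k => by
        ext z
        refine (h d ((κ.left_le k).trans_lt z.1.2)).1 ?_
        refine (Equiv.apply_symm_apply (Equiv.ofBijective _ _) _).trans ?_
        refine Eq.trans ?_ (NatTrans.naturality_apply f k _).symm
        exact congrArg (B.map k) (Equiv.apply_symm_apply (Equiv.ofBijective _ (h c z.1.2)) z.2).symm }
  have hsnd : ∀ Y : HSet.{w, v} Γ, M.mapCtx (snd V Y) = snd V (M.obj Y) := fun Y => by
    have := M.mapCtx_snd (P := V) (𝟙 Y)
    simpa using this
  have h1 : M.mapCtx s ≫ M.map f = snd _ _ := by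
    rw [← M.mapCtx_comp_map, ← hsnd]
    congr 1
    exact HSet.tensor_ext fun c v b =>
      Equiv.apply_symm_apply (Equiv.ofBijective _ (h c v.2)) b
  have h2 : V ◁ M.map f ≫ M.mapCtx s = snd _ _ := by
    rw [← M.mapCtx_whiskerLeft, ← hsnd]
    congr 1
    exact HSet.tensor_ext fun c v a =>
      Equiv.symm_apply_apply (Equiv.ofBijective _ (h c v.2)) a
  intro c hc
  let v : V.obj c := ⟨PUnit.unit, hc⟩
  refine Function.bijective_iff_has_inverse.2
    ⟨fun b => (M.mapCtx s).app c ((v, b) : (V ⊗ M.obj B).obj c), fun a => ?_, fun b => ?_⟩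
  · exact HSet.hom_ext_iff.1 h2 c ((v, a) : (V ⊗ M.obj A).obj c)
  · exact HSet.hom_ext_iff.1 h1 c ((v, b) : (V ⊗ M.obj B).obj c)

variable (G : HSet.{w, v} Γ ⥤ HSet.{w, v} Γ)

/-- The iterates of a functor on the terminal object. -/
def approx : ℕ → HSet.{w, v} Γ
  | 0 => 𝟙_ _
  | n + 1 => G.obj (approx n)

/-- The projections between the iterates of a functor on the terminal object. -/
def approxProj : ∀ n, approx G (n + 1) ⟶ approx G n
  | 0 => toUnit _
  | n + 1 => G.map (approxProj n)

variable {G}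

/-- A contractive functor has a fixed point. -/
theorem exists_fixed_of_contractive
    (hG : ∀ (n : ℕ) {A B : HSet.{w, v} Γ} (f : A ⟶ B), κ.BijBelow n f →
      κ.BijBelow (n + 1) (G.map f)) :
    ∃ F, Nonempty (G.obj F ≅ F) := by
  let D := Functor.ofOpSequence (approxProj G)
  have hp : ∀ n, κ.BijBelow n (approxProj G n) := fun n => by
    induction n with
    | zero => exact fun c hc => absurd hc (Nat.not_lt_zero _)
    | succ n ih => exact hG n _ ih
  let F := Limits.limit D
  let π : ∀ n, F ⟶ approx G n := fun n => Limits.limit.π D (Opposite.op n)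
  have hπ : ∀ n, π (n + 1) ≫ approxProj G n = π n := fun n => by
    have := Limits.limit.w D (homOfLE n.le_succ).op
    rwa [Functor.ofOpSequence_map_homOfLE_succ] at this
  -- Limits are computed stagewise, and at a stage with less than `n` steps left the tower is
  -- constant from index `n` on.
  have hπb : ∀ n, κ.BijBelow n (π n) := by
    intro n c hc
    have hconst : (D ⋙ (evaluation _ _).obj c).IsEventuallyConstantTo (Opposite.op n) := by
      have : ∀ k, IsIso ((D ⋙ (evaluation _ _).obj c).map (homOfLE (Nat.le_add_right n k)).op) := by
        intro k
        induction k with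
        | zero =>
          have : (homOfLE (Nat.le_add_right n 0)).op = 𝟙 (Opposite.op n) := rfl
          rw [this]; infer_instance
        | succ k ih =>
          have : (homOfLE (Nat.le_add_right n (k + 1))).op =
              (homOfLE (n + k).le_succ).op ≫ (homOfLE (Nat.le_add_right n k)).op := rfl
          rw [this, Functor.map_comp]
          have : IsIso ((D ⋙ (evaluation _ _).obj c).map (homOfLE (n + k).le_succ).op) := by
            rw [Functor.comp_map, Functor.ofOpSequence_map_homOfLE_succ]
            exact (isIso_iff_bijective _).2 (hp (n + k) c (hc.trans_le (Nat.le_add_right _ _)))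
          infer_instance
      intro j f
      obtain ⟨k, hk⟩ := Nat.exists_eq_add_of_le (leOfHom f.unop)
      obtain ⟨j⟩ := j
      obtain rfl : j = n + k := hk
      exact this k
    have := hconst.isIso_π_of_isLimit
      (Limits.isLimitOfPreserves ((evaluation _ _).obj c) (Limits.limit.isLimit D))
    exact (isIso_iff_bijective _).1 this
  let cone : Limits.Cone D :=
    { pt := G.obj F
      -- `G.map (π n)` lands in iterate `n + 1`; projecting back to iterate `n` gives a leg for
      -- every index, including `0`.
      π := NatTrans.ofOpSequence (fun n => G.map (π n) ≫ approxProj G n) fun n => by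
        have : G.map (π (n + 1)) ≫ approxProj G (n + 1) = G.map (π n) := by
          rw [← hπ n, Functor.map_comp]; rfl
        rw [Functor.ofOpSequence_map_homOfLE_succ]
        exact (Category.id_comp _).trans (congrArg (· ≫ approxProj G n) this.symm) }
  let l : G.obj F ⟶ F := Limits.limit.lift D cone
  have hl : ∀ n, l ≫ π n = G.map (π n) ≫ approxProj G n := fun n => Limits.limit.lift_π cone _
  -- At the index `κ.left c + 1` every other map in the square `hl` is bijective at `c`, hence so is
  -- `l`.
  have hiso : ∀ c, IsIso (l.app c) := fun c => by
    refine (isIso_iff_bijective _).2 ?_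
    have h1 := hπb (κ.left c + 1) c (Nat.lt_succ_self _)
    have h2 := hp (κ.left c + 1) c (Nat.lt_succ_self _)
    have h3 := ((hG _ _ (hπb (κ.left c + 1))).mono (Nat.le_succ _)) c (Nat.lt_succ_self _)
    have h4 : (π (κ.left c + 1)).app c ∘ l.app c =
        (approxProj G (κ.left c + 1)).app c ∘ (G.map (π (κ.left c + 1))).app c :=
      funext fun x => HSet.hom_ext_iff.1 (hl (κ.left c + 1)) c x
    exact (Function.Bijective.of_comp_iff' h1 _).1 (h4 ▸ h2.comp h3)
  have : IsIso l := NatIso.isIso_of_isIso_app l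
  exact ⟨F, ⟨asIso l⟩⟩

end ClockIn

/-- The functor `F ↦ T (X + ▷^κ F)`. -/
def recFunctor {Γ : Ctx.{w}} (κ : ClockIn Γ) (T : HMonad.{w, v} Γ) (X : HSet.{w, v} Γ) :
    HSet.{w, v} Γ ⥤ HSet.{w, v} Γ where
  obj F := T.obj (sumType X (κ.later.obj F))
  map f := T.map (ClockIn.sumMapRight X (κ.later.map f))
  map_id F := by
    rw [← CategoryTheory.Functor.map_id]
    congr 1
    ext c (x | x)
    · rfl
    · rfl
  map_comp f g := by
    rw [← Functor.map_comp]
    congr 1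
    ext c (x | x)
    · rfl
    · rfl

theorem exists_rec_iso {Γ : Ctx.{w}} (κ : ClockIn Γ) (T : HMonad.{w, v} Γ) (X : HSet.{w, v} Γ) :
    ∃ F : HSet.{w, v} Γ, Nonempty (T.obj (sumType X (κ.later.obj F)) ≅ F) :=
  ClockIn.exists_fixed_of_contractive (κ := κ) (G := recFunctor κ T X) fun _ _ _ _ h =>
    h.later.sumMapRight.map T.ctxFunctor

/-! ### Monads from extension of maps with parameters. -/

/-- A monad on hsets given by a unit and an extension of maps with parameters. -/
structure ExtensionSystem (Γ : Ctx.{w}) where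
  /-- the action on hsets -/
  obj : HSet.{w, v} Γ → HSet.{w, v} Γ
  /-- the unit -/
  unit : ∀ X, X ⟶ obj X
  /-- the extension of maps with parameters -/
  bind : ∀ {P X Y : HSet.{w, v} Γ}, (P ⊗ X ⟶ obj Y) → (P ⊗ obj X ⟶ obj Y)
  bind_subst : ∀ {P Q X Y : HSet.{w, v} Γ} (u : Q ⟶ P) (f : P ⊗ X ⟶ obj Y),
    bind (u ▷ X ≫ f) = u ▷ obj X ≫ bind f
  unit_bind : ∀ {P X Y : HSet.{w, v} Γ} (f : P ⊗ X ⟶ obj Y), P ◁ unit X ≫ bind f = f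
  bind_unit : ∀ {P X : HSet.{w, v} Γ}, bind (snd P X ≫ unit X) = snd P (obj X)
  bind_bind : ∀ {P X Y Z : HSet.{w, v} Γ} (f : P ⊗ X ⟶ obj Y) (g : P ⊗ Y ⟶ obj Z),
    bind (lift (fst P X) f ≫ bind g) = lift (fst P (obj X)) (bind f) ≫ bind g

namespace ExtensionSystem

variable {Γ : Ctx.{w}} (E : ExtensionSystem.{w, v} Γ) {P X Y Z : HSet.{w, v} Γ}

/-- The extension of maps without parameters. -/
def bind₀ (f : X ⟶ E.obj Y) : E.obj X ⟶ E.obj Y :=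
  lift (toUnit _) (𝟙 _) ≫ E.bind (snd (𝟙_ (HSet.{w, v} Γ)) X ≫ f)

/-- A map that ignores its parameters arises by substitution along `P ⟶ 𝟙_`. -/
theorem bind_snd (f : X ⟶ E.obj Y) : E.bind (snd P X ≫ f) = snd P (E.obj X) ≫ E.bind₀ f := by
  have h := E.bind_subst (toUnit P) (snd (𝟙_ (HSet.{w, v} Γ)) X ≫ f)
  rw [whiskerRight_snd_assoc] at h
  rw [h, bind₀, comp_lift_assoc]
  congr 1

theorem snd_unit_cancel {f g : X ⟶ Y}
    (h : snd (𝟙_ (HSet.{w, v} Γ)) X ≫ f = snd _ X ≫ g) : f = g := by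
  simpa using congrArg (fun k => lift (toUnit _) (𝟙 _) ≫ k) h

theorem lift_fst_snd_comp (f : X ⟶ Y) : lift (fst P X) (snd P X ≫ f) = P ◁ f := by
  ext1 <;> simp

theorem unit_bind₀ (f : X ⟶ E.obj Y) : E.unit X ≫ E.bind₀ f = f := by
  refine snd_unit_cancel ?_
  rw [← E.unit_bind (snd _ X ≫ f), bind_snd, whiskerLeft_snd_assoc]

theorem bind₀_unit : E.bind₀ (E.unit X) = 𝟙 _ := by
  refine snd_unit_cancel ?_
  rw [← bind_snd, bind_unit, Category.comp_id]

theorem bind_comp_bind₀ (f : P ⊗ X ⟶ E.obj Y) (g : Y ⟶ E.obj Z) :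
    E.bind (f ≫ E.bind₀ g) = E.bind f ≫ E.bind₀ g := by
  have := E.bind_bind f (snd P Y ≫ g)
  rwa [bind_snd, lift_snd_assoc, lift_snd_assoc] at this

theorem bind_whiskerLeft (f : X ⟶ E.obj Y) (g : P ⊗ Y ⟶ E.obj Z) :
    E.bind (P ◁ f ≫ E.bind g) = P ◁ E.bind₀ f ≫ E.bind g := by
  have := E.bind_bind (snd P X ≫ f) g
  rwa [bind_snd, lift_fst_snd_comp, lift_fst_snd_comp] at this

theorem bind₀_bind₀ (f : X ⟶ E.obj Y) (g : Y ⟶ E.obj Z) :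
    E.bind₀ (f ≫ E.bind₀ g) = E.bind₀ f ≫ E.bind₀ g := by
  refine snd_unit_cancel ?_
  rw [← bind_snd, ← Category.assoc, bind_comp_bind₀, bind_snd, Category.assoc]

theorem bind₀_comp_unit_comp_bind₀ (f : X ⟶ Y) (g : Y ⟶ E.obj Z) :
    E.bind₀ (f ≫ E.unit Y) ≫ E.bind₀ g = E.bind₀ (f ≫ g) := by
  rw [← bind₀_bind₀, Category.assoc, unit_bind₀]

/-- The underlying functor. -/
def functor : HSet.{w, v} Γ ⥤ HSet.{w, v} Γ where
  obj := E.obj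
  map f := E.bind₀ (f ≫ E.unit _)
  map_id X := by rw [Category.id_comp, bind₀_unit]
  map_comp f g := by rw [← bind₀_bind₀, Category.assoc, Category.assoc, unit_bind₀]

/-- The underlying monad. -/
def monad : Monad (HSet.{w, v} Γ) where
  toFunctor := E.functor
  η := { app := E.unit, naturality := fun X Y f => (E.unit_bind₀ _).symm }
  μ :=
    { app := fun X => E.bind₀ (𝟙 _)
      naturality := fun X Y f => by
        refine (E.bind₀_comp_unit_comp_bind₀ (E.bind₀ (f ≫ E.unit Y)) (𝟙 _)).trans ?_
        refine Eq.trans ?_ (E.bind₀_bind₀ (𝟙 _) (f ≫ E.unit Y))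
        rw [Category.comp_id, Category.id_comp] }
  assoc X := by
    refine (E.bind₀_comp_unit_comp_bind₀ (E.bind₀ (𝟙 _)) (𝟙 _)).trans ?_
    refine Eq.trans ?_ (E.bind₀_bind₀ (𝟙 _) (𝟙 _))
    rw [Category.comp_id, Category.id_comp]
  left_unit X := E.unit_bind₀ _
  right_unit X := by
    refine (E.bind₀_comp_unit_comp_bind₀ (E.unit X) (𝟙 _)).trans ?_
    exact (congrArg E.bind₀ (Category.comp_id (E.unit X))).trans E.bind₀_unit

theorem bind_comp_unit_comp_bind₀ (f : P ⊗ X ⟶ Y) (g : Y ⟶ E.obj Z) :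
    E.bind (f ≫ E.unit Y) ≫ E.bind₀ g = E.bind (f ≫ g) := by
  rw [← bind_comp_bind₀, Category.assoc, unit_bind₀]

/-- The monad in the internal sense. -/
def hmonad : HMonad.{w, v} Γ where
  toMonad := E.monad
  mapCtx f := E.bind (f ≫ E.unit _)
  mapCtx_subst u f := by rw [Category.assoc]; exact E.bind_subst _ _
  mapCtx_snd f := by rw [Category.assoc]; exact E.bind_snd _
  mapCtx_comp f g := by
    refine Eq.trans ?_ (E.bind_bind _ _)
    congr 1
    have : lift (fst _ _) (f ≫ E.unit _) = lift (fst _ _) f ≫ _ ◁ E.unit _ := by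
      ext1 <;> simp
    rw [this, Category.assoc, Category.assoc, unit_bind]
  mapCtx_η f := E.unit_bind _
  mapCtx_μ f := by
    change _ ◁ E.bind₀ (𝟙 _) ≫ E.bind _ = E.bind (E.bind _ ≫ E.unit _) ≫ E.bind₀ (𝟙 _)
    rw [bind_comp_unit_comp_bind₀, ← bind_whiskerLeft]
    simp

/-- This transfers properties of the chosen extensions to those defined by the monad. -/
theorem hmonad_mapCtx_μ (f : P ⊗ X ⟶ E.obj Y) :
    E.hmonad.mapCtx f ≫ E.hmonad.μ.app Y = E.bind f :=
  (E.bind_comp_unit_comp_bind₀ f (𝟙 _)).trans (by rw [Category.comp_id])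

end ExtensionSystem

/-! ### The combined monad. -/

section Free

variable {Γ : Ctx.{w}} (κ : ClockIn Γ) (T : HMonad.{w, v} Γ)

variable {κ T} in
theorem IsFreeOn.hom_ext {X F P Y : HSet.{w, v} Γ} {A : AlgOn T F} {ξ : κ.later.obj F ⟶ F}
    {u : X ⟶ F} (hF : IsFreeOn κ T A ξ u) (B : AlgOn T Y) (ζ : κ.later.obj Y ⟶ Y)
    {g g' : P ⊗ F ⟶ Y} (h1 : IsAlgHom A B g) (h2 : IsDelayHom κ ξ ζ g)
    (h1' : IsAlgHom A B g') (h2' : IsDelayHom κ ξ ζ g') (h : P ◁ u ≫ g = P ◁ u ≫ g') : g = g' :=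
  (hF P Y B ζ (P ◁ u ≫ g')).unique ⟨h1, h2, h⟩ ⟨h1', h2', rfl⟩

/-- With solutions and extensions chosen by freeness, each law of an extension system equates two
homomorphisms for both structures that agree on `X`. -/
theorem exists_isFreeComb : ∃ (R : HMonad.{w, v} Γ)
    (e : ∀ X : HSet.{w, v} Γ, T.obj (sumType X (κ.later.obj (R.obj X))) ≅ R.obj X),
    IsFreeComb κ T R e := by
  choose R e' using exists_rec_iso κ T
  let e := fun X => (e' X).some
  have free := fun X => isFreeOn_rec κ (e X)
  choose bind alg step unit using fun {P X Y : HSet.{w, v} Γ} (f : P ⊗ X ⟶ R Y) =>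
    (free X P (R Y) (recAlg κ T (e Y)) (recStep κ T (e Y)) f).exists
  have alg' : ∀ {P X Y : HSet.{w, v} Γ} (f : P ⊗ X ⟶ R Y),
    T.ctxFunctor.IsHom (recAlg κ T (e X)).str (recAlg κ T (e Y)).str (bind f) := alg
  have step' : ∀ {P X Y : HSet.{w, v} Γ} (f : P ⊗ X ⟶ R Y),
    κ.laterFunctor.IsHom (recStep κ T (e X)) (recStep κ T (e Y)) (bind f) := step
  let E : ExtensionSystem.{w, v} Γ :=
    { obj := R
      unit := fun X => recUnit κ T (e X)
      bind := bind
      bind_subst := fun {P Q X Y} u f => by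
        refine (free X).hom_ext (recAlg κ T (e Y)) (recStep κ T (e Y)) (alg _) (step _)
          ((alg' f).subst u) ((step' f).subst u) ?_
        rw [unit, whisker_exchange_assoc, unit]
      unit_bind := unit
      bind_unit := fun {P X} => by
        refine (free X).hom_ext (recAlg κ T (e X)) (recStep κ T (e X)) (alg _) (step _)
          (CtxFunctor.isHom_snd (M := T.ctxFunctor))
          (CtxFunctor.isHom_snd (M := κ.laterFunctor)) ?_
        rw [unit, whiskerLeft_snd]
      bind_bind := fun {P X Y Z} f g => by
        refine (free X).hom_ext (recAlg κ T (e Z)) (recStep κ T (e Z)) (alg _) (step _)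
          ((alg' f).comp (alg' g)) ((step' f).comp (step' g)) ?_
        have h : P ◁ recUnit κ T (e X) ≫ lift (fst P (R X)) (bind f) = lift (fst P X) f := by
          ext1
          · simp
          · simp [unit]
        rw [unit, reassoc_of% h] }
  refine ⟨E.hmonad, e, fun X => rfl, fun {P X Y} f => ?_, fun {P X Y} f => ?_⟩
  · exact Eq.mpr (congrArg _ (E.hmonad_mapCtx_μ f)) (alg f)
  · exact Eq.mpr (congrArg _ (E.hmonad_mapCtx_μ f)) (step f)

end Free

/-! ### Algebras for the combined monad. -/

section Sums

variable {Γ : Ctx.{w}}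

namespace HMonad

variable (R : HMonad.{w, v} Γ) {P X Y : HSet.{w, v} Γ}

/-- The unit, with its domain in simplified form. -/
abbrev unit (X : HSet.{w, v} Γ) : X ⟶ R.obj X := R.η.app X

/-- The multiplication, with its domain in simplified form. -/
abbrev mult (X : HSet.{w, v} Γ) : R.obj (R.obj X) ⟶ R.obj X := R.μ.app X

theorem map_unit_mult : R.map (R.unit X) ≫ R.mult X = 𝟙 (R.obj X) := R.right_unit X

theorem unit_mult : R.unit (R.obj X) ≫ R.mult X = 𝟙 (R.obj X) := R.left_unit X

theorem mapCtx_unit_mult (f : P ⊗ X ⟶ Y) :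
    R.mapCtx (f ≫ R.unit Y) ≫ R.mult Y = R.mapCtx f := by
  have h : R.mapCtx (f ≫ R.unit Y) = R.mapCtx f ≫ R.map (R.unit Y) :=
    R.ctxFunctor.mapCtx_comp_map f (R.unit Y)
  rw [h, Category.assoc, map_unit_mult, Category.comp_id]

/-- Natural `M`-algebra structures on the hsets `R X` for which extensions are homomorphisms. -/
structure IsStrOn (M : CtxFunctor.{w, v} Γ) (R : HMonad.{w, v} Γ)
    (s : ∀ X, M.obj (R.obj X) ⟶ R.obj X) : Prop where
  isHom_bind : ∀ {P X Y : HSet.{w, v} Γ} (f : P ⊗ X ⟶ R.obj Y),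
    M.IsHom (s X) (s Y) (R.mapCtx f ≫ R.mult Y)

namespace IsStrOn

variable {R} {M : CtxFunctor.{w, v} Γ} {s : ∀ X, M.obj (R.obj X) ⟶ R.obj X} (hs : IsStrOn M R s)

include hs in
theorem isHom_mapCtx (f : P ⊗ X ⟶ Y) : M.IsHom (s X) (s Y) (R.mapCtx f) := by
  rw [← R.mapCtx_unit_mult]
  exact hs.isHom_bind _

include hs in
theorem str_map (f : X ⟶ Y) : s X ≫ R.map f = M.map (R.map f) ≫ s Y := by
  refine CtxFunctor.IsHom.of_snd ?_
  rw [← R.mapCtx_snd]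
  exact hs.isHom_mapCtx _

include hs in
-- The multiplication is the extension of the identity.
theorem str_mult (X : HSet.{w, v} Γ) : s (R.obj X) ≫ R.mult X = M.map (R.mult X) ≫ s X := by
  refine CtxFunctor.IsHom.of_snd ?_
  have h := hs.isHom_bind (snd (𝟙_ (HSet.{w, v} Γ)) (R.obj X) ≫ 𝟙 _)
  rwa [R.mapCtx_snd, CategoryTheory.Functor.map_id, Category.comp_id] at h

end IsStrOn

variable {R} {M : CtxFunctor.{w, v} Γ}

/-- The `M`-algebra structure on an `R`-algebra. -/
def restrict (s : ∀ X, M.obj (R.obj X) ⟶ R.obj X) (a : AlgOn R Y) : M.obj Y ⟶ Y :=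
  M.map (R.unit Y) ≫ s Y ≫ a.str

variable {s : ∀ X, M.obj (R.obj X) ⟶ R.obj X} (hs : IsStrOn M R s)

include hs in
-- Associativity of `a` replaces `a.str` after `R.map a.str` by `a.str` after the multiplication,
-- which is itself a homomorphism and is split by the unit.
theorem str_comp_alg (a : AlgOn R Y) : s Y ≫ a.str = M.map a.str ≫ restrict s a := by
  have h1 : M.map a.str ≫ M.map (R.unit Y) = M.map (R.unit (R.obj Y)) ≫ M.map (R.map a.str) := by
    rw [← M.map_comp, ← M.map_comp]
    exact congrArg _ (R.toMonad.unit_naturality _ a.str)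
  have h2 : R.map a.str ≫ a.str = R.mult Y ≫ a.str := a.assoc.symm
  have h3 : M.map (R.unit (R.obj Y)) ≫ M.map (R.mult Y) = 𝟙 _ := by
    rw [← M.map_comp, unit_mult, M.map_id]
  rw [restrict, reassoc_of% h1, ← reassoc_of% (hs.str_map a.str), h2,
    reassoc_of% (hs.str_mult Y), reassoc_of% h3]

include hs in
theorem isHom_restrict {Z : HSet.{w, v} Γ} {a : AlgOn R Y} {b : AlgOn R Z} {f : P ⊗ Y ⟶ Z}
    (hf : IsAlgHom a b f) : M.IsHom (restrict s a) (restrict s b) f := by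
  have h1 : P ◁ s Y ≫ R.mapCtx f = M.mapCtx (R.mapCtx f) ≫ s Z := hs.isHom_mapCtx f
  have h2 : P ◁ M.map (R.unit Y) ≫ M.mapCtx (R.mapCtx f) = M.mapCtx f ≫ M.map (R.unit Z) := by
    rw [← M.mapCtx_whiskerLeft, ← M.mapCtx_comp_map]
    exact congrArg _ (R.mapCtx_η f)
  rw [CtxFunctor.IsHom, restrict, restrict, whiskerLeft_comp₃]
  rw [IsAlgHom] at hf
  rw [hf, reassoc_of% h1, reassoc_of% h2]

/-- The unit splits `a.str`, so at most one structure on `Y` makes `a.str` a homomorphism. -/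
theorem restrict_eq {a : AlgOn R Y} {b : M.obj Y ⟶ Y} (h : s Y ≫ a.str = M.map a.str ≫ b) :
    restrict s a = b := by
  have h1 : M.map (R.unit Y) ≫ M.map a.str = 𝟙 _ := by
    rw [← M.map_comp, ← M.map_id]
    exact congrArg _ a.unit
  rw [restrict, h, reassoc_of% h1]

end HMonad

namespace IsFreeComb

variable {κ : ClockIn Γ} {T R : HMonad.{w, v} Γ}
  {e : ∀ X : HSet.{w, v} Γ, T.obj (sumType X (κ.later.obj (R.obj X))) ≅ R.obj X}
  (hR : IsFreeComb κ T R e) {P X Y Z : HSet.{w, v} Γ}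

include hR in
theorem isStrOn_alg : HMonad.IsStrOn T.ctxFunctor R fun X => (recAlg κ T (e X)).str :=
  ⟨fun f => hR.bind_alg f⟩

include hR in
theorem isStrOn_step : HMonad.IsStrOn κ.laterFunctor R fun X => recStep κ T (e X) :=
  ⟨fun f => hR.bind_step f⟩

/-- The `T`-algebra structure on an `R`-algebra. -/
def toAlg (a : AlgOn R Y) : AlgOn T Y where
  str := HMonad.restrict (M := T.ctxFunctor) (fun X => (recAlg κ T (e X)).str) a
  unit := by
    have h1 : T.unit Y ≫ T.map (R.unit Y) = R.unit Y ≫ T.unit (R.obj Y) :=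
      (T.toMonad.unit_naturality _ (R.unit Y)).symm
    have h2 : T.unit (R.obj Y) ≫ (recAlg κ T (e Y)).str = 𝟙 _ := (recAlg κ T (e Y)).unit
    change T.unit Y ≫ T.map (R.unit Y) ≫ (recAlg κ T (e Y)).str ≫ a.str = 𝟙 Y
    rw [reassoc_of% h1, reassoc_of% h2]
    exact a.unit
  assoc := by
    have h := HMonad.str_comp_alg hR.isStrOn_alg a
    dsimp only at h
    have h1 : T.mult Y ≫ T.map (R.unit Y) = T.map (T.map (R.unit Y)) ≫ T.mult (R.obj Y) :=
      (T.toMonad.mu_naturality _ (R.unit Y)).symm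
    have h2 : T.mult (R.obj Y) ≫ (recAlg κ T (e Y)).str =
      T.map (recAlg κ T (e Y)).str ≫ (recAlg κ T (e Y)).str := (recAlg κ T (e Y)).assoc
    change T.mult Y ≫ T.map (R.unit Y) ≫ (recAlg κ T (e Y)).str ≫ a.str =
      T.map (T.map (R.unit Y) ≫ (recAlg κ T (e Y)).str ≫ a.str) ≫ _
    rw [reassoc_of% h1, reassoc_of% h2]
    refine (congrArg (fun k => T.map (T.map (R.unit Y)) ≫ T.map (recAlg κ T (e Y)).str ≫ k)
      h).trans ?_
    simp only [Functor.map_comp, Category.assoc]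

/-- The delay algebra structure on an `R`-algebra. -/
def toStep (e : ∀ X : HSet.{w, v} Γ, T.obj (sumType X (κ.later.obj (R.obj X))) ≅ R.obj X)
    (a : AlgOn R Y) : κ.later.obj Y ⟶ Y :=
  HMonad.restrict (M := κ.laterFunctor) (fun X => recStep κ T (e X)) a

variable (e) in
/-- The identity extends to a homomorphism from the free object. -/
theorem exists_counit (B : AlgOn T Y) (ζ : κ.later.obj Y ⟶ Y) :
    ∃ a : R.obj Y ⟶ Y, (recAlg κ T (e Y)).str ≫ a = T.map a ≫ B.str ∧
      recStep κ T (e Y) ≫ a = κ.later.map a ≫ ζ ∧ recUnit κ T (e Y) ≫ a = 𝟙 Y := by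
  obtain ⟨g, h1, h2, h3⟩ := (isFreeOn_rec κ (e Y) (𝟙_ _) Y B ζ (snd _ _)).exists
  obtain ⟨a, rfl⟩ : ∃ a, g = snd _ _ ≫ a := by
    refine ⟨lift (toUnit _) (𝟙 _) ≫ g, ?_⟩
    rw [comp_lift_assoc]
    have : lift (snd (𝟙_ (HSet.{w, v} Γ)) (R.obj Y) ≫ toUnit _) (snd _ _ ≫ 𝟙 _) = 𝟙 _ := by
      ext1
      · exact toUnit_unique _ _
      · simp
    rw [this, Category.id_comp]
  refine ⟨a, CtxFunctor.IsHom.of_snd (M := T.ctxFunctor) h1,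
    CtxFunctor.IsHom.of_snd (M := κ.laterFunctor) h2, ExtensionSystem.snd_unit_cancel ?_⟩
  rw [Category.comp_id, ← whiskerLeft_snd_assoc, h3]

include hR in
theorem hom_ext {B : AlgOn T Y} {ζ : κ.later.obj Y ⟶ Y} {g g' : P ⊗ R.obj X ⟶ Y}
    (h1 : T.ctxFunctor.IsHom (recAlg κ T (e X)).str B.str g)
    (h2 : κ.laterFunctor.IsHom (recStep κ T (e X)) ζ g)
    (h1' : T.ctxFunctor.IsHom (recAlg κ T (e X)).str B.str g')
    (h2' : κ.laterFunctor.IsHom (recStep κ T (e X)) ζ g')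
    (h : P ◁ R.unit X ≫ g = P ◁ R.unit X ≫ g') : g = g' := by
  refine (isFreeOn_rec κ (e X)).hom_ext B ζ h1 h2 h1' h2' ?_
  rwa [← hR.unit X]

include hR in
theorem hom_ext₀ {B : AlgOn T Y} {ζ : κ.later.obj Y ⟶ Y} {g g' : R.obj X ⟶ Y}
    (h1 : (recAlg κ T (e X)).str ≫ g = T.map g ≫ B.str)
    (h2 : recStep κ T (e X) ≫ g = κ.later.map g ≫ ζ)
    (h1' : (recAlg κ T (e X)).str ≫ g' = T.map g' ≫ B.str)
    (h2' : recStep κ T (e X) ≫ g' = κ.later.map g' ≫ ζ)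
    (h : R.unit X ≫ g = R.unit X ≫ g') : g = g' := by
  refine ExtensionSystem.snd_unit_cancel (hR.hom_ext (B := B) (ζ := ζ)
    (CtxFunctor.isHom_snd_comp h1) (CtxFunctor.isHom_snd_comp h2)
    (CtxFunctor.isHom_snd_comp h1') (CtxFunctor.isHom_snd_comp h2') ?_)
  rw [whiskerLeft_snd_assoc, whiskerLeft_snd_assoc, h]

include hR in
-- The structure map is the homomorphism extending the identity of `Y`. Its associativity law
-- compares two homomorphisms out of the free object on `R Y`, both restricting to the structure map
-- along the unit.
theorem exists_alg (B : AlgOn T Y) (ζ : κ.later.obj Y ⟶ Y) :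
    ∃ a : AlgOn R Y, (recAlg κ T (e Y)).str ≫ a.str = T.map a.str ≫ B.str ∧
      recStep κ T (e Y) ≫ a.str = κ.later.map a.str ≫ ζ := by
  obtain ⟨a, h1, h2, h3⟩ := exists_counit e B ζ
  rw [← hR.unit] at h3
  refine ⟨⟨a, h3, ?_⟩, h1, h2⟩
  have m1 := hR.isStrOn_alg.str_mult Y
  have m2 := hR.isStrOn_step.str_mult Y
  have f1 := hR.isStrOn_alg.str_map a
  have f2 := hR.isStrOn_step.str_map a
  dsimp only at m1 m2 f1 f2
  change R.mult Y ≫ a = R.map a ≫ a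
  refine hR.hom_ext₀ (B := B) (ζ := ζ) ?_ ?_ ?_ ?_ ?_
  · rw [reassoc_of% m1, h1, Functor.map_comp, Category.assoc]
  · rw [reassoc_of% m2, h2, Functor.map_comp, Category.assoc]
  · rw [reassoc_of% f1, h1, Functor.map_comp, Category.assoc]
  · rw [reassoc_of% f2, h2, Functor.map_comp, Category.assoc]
  · have h4 : R.unit (R.obj Y) ≫ R.map a = a ≫ R.unit Y :=
      (R.toMonad.unit_naturality _ a).symm
    have h5 : R.unit Y ≫ a = 𝟙 Y := h3
    rw [reassoc_of% R.unit_mult, reassoc_of% h4, h5, Category.comp_id]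

include hR in
-- An `R`-algebra structure is a homomorphism out of the free object on `Y` that restricts to the
-- identity, so freeness makes the induced pair determine it; `exists_alg` realizes every pair.
theorem toAlg_toStep_bijective :
    Function.Bijective fun a : AlgOn R Y => (hR.toAlg a, toStep e a) := by
  constructor
  · intro a b hab
    obtain ⟨hab1, hab2⟩ := Prod.ext_iff.1 hab
    dsimp only at hab1 hab2
    refine AlgOn.ext (hR.hom_ext₀ (B := hR.toAlg a) (ζ := toStep e a) ?_ ?_ ?_ ?_ ?_)
    · exact HMonad.str_comp_alg hR.isStrOn_alg a
    · exact HMonad.str_comp_alg hR.isStrOn_step a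
    · rw [hab1]; exact HMonad.str_comp_alg hR.isStrOn_alg b
    · rw [hab2]; exact HMonad.str_comp_alg hR.isStrOn_step b
    · exact a.unit.trans b.unit.symm
  · rintro ⟨B, ζ⟩
    obtain ⟨a, h1, h2⟩ := hR.exists_alg B ζ
    exact ⟨a, Prod.ext
      (AlgOn.ext (HMonad.restrict_eq (M := T.ctxFunctor) (s := fun X => (recAlg κ T (e X)).str) h1))
      (HMonad.restrict_eq (M := κ.laterFunctor) (s := fun X => recStep κ T (e X)) h2)⟩

include hR in
-- For the converse, both sides of the homomorphism equation are homomorphisms out of the free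
-- object on `Y`, and both restrict to `f`.
theorem isAlgHom_iff (a : AlgOn R Y) (b : AlgOn R Z) (f : P ⊗ Y ⟶ Z) :
    IsAlgHom a b f ↔
      IsAlgHom (hR.toAlg a) (hR.toAlg b) f ∧ IsDelayHom κ (toStep e a) (toStep e b) f := by
  refine ⟨fun h => ⟨HMonad.isHom_restrict hR.isStrOn_alg h,
    HMonad.isHom_restrict hR.isStrOn_step h⟩, fun ⟨h1, h2⟩ => ?_⟩
  have ha : P ◁ R.unit Y ≫ P ◁ a.str ≫ f = f := by
    have : R.unit Y ≫ a.str = 𝟙 Y := a.unit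
    rw [← whiskerLeft_comp_assoc, this]; simp
  have hb : P ◁ R.unit Y ≫ R.mapCtx f ≫ b.str = f := b.η_extend f
  refine hR.hom_ext (B := hR.toAlg b) (ζ := toStep e b)
    (CtxFunctor.IsHom.comp_left (HMonad.str_comp_alg hR.isStrOn_alg a) h1)
    (CtxFunctor.IsHom.comp_left (HMonad.str_comp_alg hR.isStrOn_step a) h2)
    ((hR.isStrOn_alg.isHom_mapCtx f).comp_right (HMonad.str_comp_alg hR.isStrOn_alg b))
    ((hR.isStrOn_step.isHom_mapCtx f).comp_right (HMonad.str_comp_alg hR.isStrOn_step b))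
    (ha.trans hb.symm)

end IsFreeComb

/-! ### The delay monad as the case of the identity monad, and the sum. -/

variable (Γ) in
/-- The identity monad. -/
def HMonad.identity : HMonad.{w, v} Γ where
  toMonad := Monad.id _
  mapCtx f := f
  mapCtx_subst _ _ := rfl
  mapCtx_snd _ := rfl
  mapCtx_comp _ _ := rfl
  mapCtx_η f := by
    change _ ◁ 𝟙 _ ≫ f = f ≫ 𝟙 _
    simp
  mapCtx_μ f := by
    change _ ◁ 𝟙 _ ≫ f = f ≫ 𝟙 _
    simp

theorem AlgOn.str_identity {Y : HSet.{w, v} Γ} (A : AlgOn (HMonad.identity Γ) Y) :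
    A.str = 𝟙 Y := (Category.id_comp A.str).symm.trans A.unit

theorem isAlgHom_identity {P Y Z : HSet.{w, v} Γ} (A : AlgOn (HMonad.identity Γ) Y)
    (B : AlgOn (HMonad.identity Γ) Z) (f : P ⊗ Y ⟶ Z) : IsAlgHom A B f := by
  rw [IsAlgHom, A.str_identity, B.str_identity]
  change P ◁ 𝟙 Y ≫ f = f ≫ 𝟙 Z
  simp

/-- The delay monad is the combination of the identity monad with delays. -/
theorem isFreeComb_identity_iff (κ : ClockIn Γ) (D : HMonad.{w, v} Γ)
    (d : ∀ X : HSet.{w, v} Γ, sumType X (κ.later.obj (D.obj X)) ≅ D.obj X) :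
    IsFreeComb κ (HMonad.identity Γ) D d ↔ IsDelayMonad κ D d :=
  ⟨fun h => ⟨h.unit, h.bind_step⟩, fun h => ⟨h.unit, fun _ => isAlgHom_identity _ _ _, h.bind_step⟩⟩

/-- The correspondence for `R` yields a `T`-algebra with a bare delay algebra. The same
correspondence for `D`, whose identity-monad component carries no information, trades delay algebras
for `D`-algebras. -/
theorem isMonadSum_of_isFreeComb {κ : ClockIn Γ} {T D R : HMonad.{w, v} Γ}
    {d : ∀ X : HSet.{w, v} Γ, sumType X (κ.later.obj (D.obj X)) ≅ D.obj X}
    {e : ∀ X : HSet.{w, v} Γ, T.obj (sumType X (κ.later.obj (R.obj X))) ≅ R.obj X}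
    (hD : IsDelayMonad κ D d) (hR : IsFreeComb κ T R e) : IsMonadSum R T D := by
  have hD' := (isFreeComb_identity_iff κ D d).2 hD
  let ι (Y : HSet.{w, v} Γ) : AlgOn (HMonad.identity Γ) Y :=
    ⟨𝟙 Y, Category.comp_id (𝟙 Y), rfl⟩
  have hstep : ∀ Y : HSet.{w, v} Γ, Function.Bijective
      fun a : AlgOn D Y => IsFreeComb.toStep (T := HMonad.identity Γ) d a := fun Y => by
    refine ⟨fun a b hab => hD'.toAlg_toStep_bijective.1 (Prod.ext (AlgOn.ext ?_) hab),
      fun ζ => ?_⟩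
    · rw [AlgOn.str_identity, AlgOn.str_identity]
    · obtain ⟨a, ha⟩ := hD'.toAlg_toStep_bijective.2 (ι Y, ζ)
      exact ⟨a, congrArg Prod.snd ha⟩
  have hhom : ∀ {P Y Z : HSet.{w, v} Γ} (a : AlgOn D Y) (b : AlgOn D Z) (f : P ⊗ Y ⟶ Z),
      IsAlgHom a b f ↔ IsDelayHom κ (IsFreeComb.toStep (T := HMonad.identity Γ) d a)
        (IsFreeComb.toStep (T := HMonad.identity Γ) d b) f := fun a b f => by
    rw [hD'.isAlgHom_iff]
    exact and_iff_right (isAlgHom_identity _ _ _)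
  let φ (Y : HSet.{w, v} Γ) := Equiv.ofBijective _ (hstep Y)
  refine ⟨fun Y => (Equiv.ofBijective _ (hR.toAlg_toStep_bijective (Y := Y))).trans
    ((Equiv.refl _).prodCongr (φ Y).symm), fun {P Y Z} A B f => ?_⟩
  rw [hR.isAlgHom_iff, hhom]
  have hφ : ∀ (Y : HSet.{w, v} Γ) (ζ : κ.later.obj Y ⟶ Y),
      IsFreeComb.toStep (T := HMonad.identity Γ) d ((φ Y).symm ζ) = ζ :=
    fun Y ζ => (φ Y).apply_symm_apply ζ
  exact and_congr Iff.rfl (iff_of_eq (congrArg₂ (fun ξ ζ => IsDelayHom κ ξ ζ f)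
    (hφ Y (IsFreeComb.toStep e A)).symm (hφ Z (IsFreeComb.toStep e B)).symm))

end Sums

theorem proposition4p4 (Γ : Ctx.{w}) (κ : ClockIn Γ) (T : HMonad.{w, v} Γ) :
    -- the guarded recursive type `F ≃ T (X + ▷^κ F)` exists
    (∀ X : HSet.{w, v} Γ, ∃ F : HSet.{w, v} Γ,
      Nonempty (T.obj (sumType X (κ.later.obj F)) ≅ F)) ∧
    -- it is the carrier of the free `T`-algebra and delay algebra structure
    (∀ (X F : HSet.{w, v} Γ) (e : T.obj (sumType X (κ.later.obj F)) ≅ F),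
      IsFreeOn κ T (recAlg κ T e) (recStep κ T e) (recUnit κ T e)) ∧
    -- the guarded delay monad `D^κ` and the monad `T ⊕ D^κ` exist
    (∃ (D : HMonad.{w, v} Γ)
      (d : ∀ X : HSet.{w, v} Γ, sumType X (κ.later.obj (D.obj X)) ≅ D.obj X),
      IsDelayMonad κ D d) ∧
    (∃ (R : HMonad.{w, v} Γ)
      (e : ∀ X : HSet.{w, v} Γ, T.obj (sumType X (κ.later.obj (R.obj X))) ≅ R.obj X),
      IsFreeComb κ T R e) ∧
    -- the latter is the sum of `T` and `D^κ`
    (∀ (D : HMonad.{w, v} Γ)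
      (d : ∀ X : HSet.{w, v} Γ, sumType X (κ.later.obj (D.obj X)) ≅ D.obj X)
      (R : HMonad.{w, v} Γ)
      (e : ∀ X : HSet.{w, v} Γ, T.obj (sumType X (κ.later.obj (R.obj X))) ≅ R.obj X),
      IsDelayMonad κ D d → IsFreeComb κ T R e → IsMonadSum R T D) := by
  refine ⟨exists_rec_iso κ T, fun X F e => isFreeOn_rec κ e, ?_, exists_isFreeComb κ T,
    fun D d R e hD hR => isMonadSum_of_isFreeComb hD hR⟩
  obtain ⟨D, d, h⟩ := exists_isFreeComb κ (HMonad.identity Γ)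
  exact ⟨D, d, (isFreeComb_identity_iff κ D d).1 h⟩
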